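/- Theorem (Equivalence TO and ETO polytopes). Let $n\in\mathbb N$ and let $d=(d_1,\dots,d_n)$ be a probability vector with all $d_i>0$. Write $d^\downarrow$ for the vector obtained from $d$ by permuting its components into non-increasing order. A real $n\times n$ matrix $M$ is called $d$-stochastic if its entries are nonnegative, each of its columns sums to $1$, and $Md=d$; let $\mathcal P_{\mathrm{TO}}(d)$ be the set of all $d$-stochastic matrices. For $1\le i<j\le n$ let $P^{d^\downarrow}(i,j)$ be the $n\times n$ matrix that agrees with the identity except for $$P^{d^\downarrow}(i,j)_{i,i}=1-\frac{d^\downarrow_j}{d^\downarrow_i},\quad P^{d^\downarrow}(i,j)_{i,j}=1,\quad P^{d^\downarrow}(i,j)_{j,i}=\frac{d^\downarrow_j}{d^\downarrow_i},\quad P^{d^\downarrow}(i,j)_{j,j}=0,$$ and let $P^{d^\downarrow}(i,i)$ be the identity. A $d$-swap is a matrix of the form $Q^{T}P^{d^\downarrow}(i,j)\,Q$ with $1\le i\le j\le n$ and $Q$ a permutation matrix such that $Qd=d^\downarrow$. Let $\mathcal P_{\mathrm{ETO}}(d)$ be the set of all (finite) convex combinations of (finite) products of $d$-swaps. Strong elementary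 thermal operations are called universal for $d$ if every $M\in\mathcal P_{\mathrm{TO}}(d)$ belongs to $\mathcal P_{\mathrm{ETO}}(d)$. Then $\mathcal P_{\mathrm{TO}}(d)=\mathcal P_{\mathrm{ETO}}(d)$ if and only if there are real numbers $0<\delta_1\le\delta_0$ such that $d^\downarrow=(\delta_0,\dots,\delta_0,\delta_1)$, that is, such that $d^\downarrow_i=\delta_0$ for $1\le i<n$ and $d^\downarrow_n=\delta_1$. Likewise, strong elementary thermal operations are universal for $d$ if and only if $d^\downarrow$ has this form. -/

import Mathlib

open scoped Matrix

namespace ThermalOperations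

/-- The rearrangement `d↓` of `d` in non-increasing order. -/
noncomputable def decreasing {n : ℕ} (d : Fin n → ℝ) : Fin n → ℝ :=
  d ∘ Tuple.sort (fun i => -d i)

lemma decreasing_antitone {n : ℕ} (d : Fin n → ℝ) : Antitone (decreasing d) := by
  intro i j hij
  have h := Tuple.monotone_sort (fun i => -d i) hij
  simpa [decreasing] using h

/-- A matrix is `d`-stochastic if it is (column) stochastic, i.e. it has nonnegative entries and
each of its columns sums to one, and it fixes `d`. -/
def IsDStochastic {n : ℕ} (d : Fin n → ℝ) (M : Matrix (Fin n) (Fin n) ℝ) : Prop :=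
  M ∈ Matrix.colStochastic ℝ (Fin n) ∧ M *ᵥ d = d

/-- The polytope of thermal operations: the set of `d`-stochastic matrices. -/
def polytopeTO {n : ℕ} (d : Fin n → ℝ) : Set (Matrix (Fin n) (Fin n) ℝ) :=
  {M | IsDStochastic d M}

/-- For a non-increasing positive vector `e` and `i < j`, the matrix that equals the identity
except in the rows and columns `i, j`, where it is `!![1 - e j / e i, 1; e j / e i, 0]`.
For `i = j` it is the identity. -/
noncomputable def orderedSwap {n : ℕ} (e : Fin n → ℝ) (i j : Fin n) :
    Matrix (Fin n) (Fin n) ℝ :=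
  if i = j then 1
  else Matrix.of fun k l =>
    if k = i ∧ l = i then 1 - e j / e i
    else if k = i ∧ l = j then 1
    else if k = j ∧ l = i then e j / e i
    else if k = j ∧ l = j then 0
    else if k = l then 1
    else 0

/-- `P` is a `d`-swap if `P = Qᵀ * P' * Q`, where `Q` is a permutation matrix with `Q d = d↓` and
`P'` is a swap of two levels `i ≤ j` for the ordered vector `d↓`. -/
def IsDSwap {n : ℕ} (d : Fin n → ℝ) (P : Matrix (Fin n) (Fin n) ℝ) : Prop :=
  ∃ (σ : Equiv.Perm (Fin n)) (i j : Fin n), i ≤ j ∧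
    σ.permMatrix ℝ *ᵥ d = decreasing d ∧
    P = (σ.permMatrix ℝ)ᵀ * orderedSwap (decreasing d) i j * σ.permMatrix ℝ

/-- The matrices that are products of finite sequences of `d`-swaps. -/
def dSwapProducts {n : ℕ} (d : Fin n → ℝ) : Set (Matrix (Fin n) (Fin n) ℝ) :=
  {M | ∃ L : List (Matrix (Fin n) (Fin n) ℝ), (∀ P ∈ L, IsDSwap d P) ∧ M = L.prod}

/-- The polytope of strong elementary thermal operations: the set of convex combinations of
products of `d`-swaps. -/
def polytopeETO {n : ℕ} (d : Fin n → ℝ) : Set (Matrix (Fin n) (Fin n) ℝ) :=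
  convexHull ℝ (dSwapProducts d)

/-- Strong elementary thermal operations are universal for `d` if every thermal operation can be
realized as a convex combination of products of `d`-swaps. -/
def StrongETOUniversal {n : ℕ} (d : Fin n → ℝ) : Prop :=
  ∀ M ∈ polytopeTO d, M ∈ polytopeETO d

/-- `d↓ = (d₀, …, d₀, d₁)` for some `0 < d₁ ≤ d₀`. -/
def HasFlatForm {n : ℕ} (d : Fin n → ℝ) : Prop :=
  ∃ d₀ d₁ : ℝ, 0 < d₁ ∧ d₁ ≤ d₀ ∧
    decreasing d = fun i : Fin n => if (i : ℕ) + 1 = n then d₁ else d₀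

end ThermalOperations

open scoped Matrix Pointwise

namespace ThermalOperations

/-! ### Swaps as rank-one updates, independent of the chosen ordering -/

variable {n : ℕ}

/-! Products of `d`-swaps are `d`-stochastic and `polytopeTO d` is convex, so both equivalences come
down to universality.

If `d↓` is not flat, three levels satisfy d_a > d_b ≥ d_c. On them lives an explicit 3×3 block
which, extended by the identity, is the only `d`-stochastic matrix supported in its zero pattern,
hence extreme. Were it in the convex hull of swap products, it would itself be such a product. But
its inequalities between rows (`IsSwapRigid`) survive removal of any leftmost swap, while the
identity, where the removal ends, is not rigid (`not_universal_of_triple`).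

If `d↓` is flat, with exceptional level `z` and r = δ₁/δ₀, a Birkhoff-type peeling works. Hall's
theorem finds in the support of M a permutation α and, if r < 1, also a permutation β fixing z and
supported there off column z. The matrix with columns r e_{α j} + (1 - r) e_{β j} for j ≠ z, and
e_{α z} for j = z, lies in `polytopeETO d`; subtracting its largest admissible multiple from M kills
an entry, and one inducts on the size of the support (`mem_smul_polytopeETO`). -/

lemma orderedSwap_eq (e : Fin n → ℝ) {i : Fin n} (hi : e i ≠ 0) (j : Fin n) :
    orderedSwap e i j = 1 + Matrix.vecMulVec (Pi.single i 1 - Pi.single j 1)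
      (Pi.single j 1 - (e j / e i) • Pi.single i 1) := by
  ext k l
  by_cases hij : i = j
  · simp [orderedSwap, hij]
  · have hji : j ≠ i := Ne.symm hij
    by_cases h1 : k = i
    · subst h1
      by_cases h3 : l = k
      · subst h3; simp [orderedSwap, hij, Matrix.vecMulVec_apply]; ring
      · by_cases h4 : l = j
        · subst h4; simp [orderedSwap, hij, h3, Matrix.vecMulVec_apply]
        · simp [orderedSwap, hij, h3, h4, Matrix.vecMulVec_apply, Ne.symm h3]
    · by_cases h2 : k = j
      · subst h2
        by_cases h3 : l = i
        · subst h3; simp [orderedSwap, h1, hij, Matrix.vecMulVec_apply]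
        · by_cases h4 : l = k
          · subst h4; simp [orderedSwap, h1, hij, Matrix.vecMulVec_apply]
          · simp [orderedSwap, hij, h1, h3, h4, Matrix.vecMulVec_apply, Ne.symm h4]
      · simp [orderedSwap, hij, h1, h2, Matrix.vecMulVec_apply, Matrix.one_apply]

lemma orderedSwap_mul_apply (e : Fin n → ℝ) {i : Fin n} (hi : e i ≠ 0) (j : Fin n)
    (N : Matrix (Fin n) (Fin n) ℝ) (k l : Fin n) :
    (orderedSwap e i j * N) k l = N k l +
      ((if k = i then 1 else 0) - (if k = j then 1 else 0)) * (N j l - e j / e i * N i l) := by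
  rw [orderedSwap_eq e hi, add_mul, one_mul, Matrix.vecMulVec_mul, Matrix.add_apply,
    Matrix.vecMulVec_apply, Matrix.sub_vecMul, Matrix.smul_vecMul]
  simp [Pi.single_apply]

lemma orderedSwap_comm (e : Fin n → ℝ) {i j : Fin n} (hi : e i ≠ 0) (h : e i = e j) :
    orderedSwap e i j = orderedSwap e j i := by
  ext k l
  rw [orderedSwap_eq e hi, orderedSwap_eq e (h ▸ hi)]
  simp [Matrix.vecMulVec_apply, h, div_self (h ▸ hi : e j ≠ 0)]
  ring

lemma orderedSwap_isDStochastic {e : Fin n → ℝ} (he : ∀ i, 0 < e i) {i j : Fin n}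
    (hij : e j ≤ e i) : IsDStochastic e (orderedSwap e i j) := by
  refine ⟨Matrix.mem_colStochastic_iff_sum.2 ⟨fun k l => ?_, fun l => ?_⟩, ?_⟩
  · have h0 : 0 ≤ e j / e i := div_nonneg (he j).le (he i).le
    have h1 : e j / e i ≤ 1 := (div_le_one (he i)).2 hij
    unfold orderedSwap
    split_ifs with h
    · rw [Matrix.one_apply]; split_ifs <;> norm_num
    · simp only [Matrix.of_apply]
      split_ifs <;> linarith
  · rw [orderedSwap_eq e (he i).ne']
    simp [Matrix.vecMulVec_apply, Finset.sum_add_distrib, ← Finset.sum_mul, Matrix.one_apply]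
  · rw [orderedSwap_eq e (he i).ne', Matrix.add_mulVec, Matrix.one_mulVec,
      Matrix.vecMulVec_mulVec]
    simp [sub_dotProduct, (he i).ne']

lemma permMatrix_conj_orderedSwap (d : Fin n → ℝ) (σ : Equiv.Perm (Fin n)) (i j : Fin n) :
    (σ.permMatrix ℝ)ᵀ * orderedSwap (d ∘ σ) i j * σ.permMatrix ℝ =
      orderedSwap d (σ i) (σ j) := by
  have h : (σ.permMatrix ℝ)ᵀ * orderedSwap (d ∘ σ) i j * σ.permMatrix ℝ =
      (orderedSwap (d ∘ σ) i j).submatrix σ.symm σ.symm := by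
    ext k l
    simp [Matrix.mul_apply, Equiv.Perm.permMatrix, PEquiv.toMatrix_apply, Equiv.toPEquiv_apply,
      ← Equiv.eq_symm_apply]
    simp [← Equiv.symm_apply_eq]
  rw [h]
  ext k l
  by_cases hij : i = j
  · simp [orderedSwap, hij, Matrix.one_apply]
  · simp [orderedSwap, hij, Equiv.symm_apply_eq]

/-- Removes the sorting permutation: conjugation only relabels the levels. With ties the sorted
order may disagree with the given order of the pair, but then the swap is symmetric in the two
levels. -/
lemma isDSwap_iff {d : Fin n → ℝ} (hd : ∀ i, 0 < d i) (P : Matrix (Fin n) (Fin n) ℝ) :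
    IsDSwap d P ↔ ∃ i j, d j ≤ d i ∧ P = orderedSwap d i j := by
  constructor
  · rintro ⟨σ, i, j, hij, hσ, rfl⟩
    rw [Matrix.permMatrix_mulVec] at hσ
    refine ⟨σ i, σ j, ?_, ?_⟩
    · have := decreasing_antitone d hij
      rw [← hσ] at this
      exact this
    · rw [← hσ, permMatrix_conj_orderedSwap]
  · rintro ⟨i, j, hij, rfl⟩
    set σ := Tuple.sort (fun i => -d i) with hσ
    have key : ∀ i j, σ.symm i ≤ σ.symm j → IsDSwap d (orderedSwap d i j) := by
      intro i j h
      refine ⟨σ, σ.symm i, σ.symm j, h, by rw [Matrix.permMatrix_mulVec]; rfl, ?_⟩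
      rw [show decreasing d = d ∘ σ from rfl, permMatrix_conj_orderedSwap]
      simp
    rcases le_total (σ.symm i) (σ.symm j) with h | h
    · exact key i j h
    · have h2 := decreasing_antitone d h
      have h3 : d i ≤ d j := by simpa [decreasing, ← hσ] using h2
      rw [orderedSwap_comm d (hd i).ne' (le_antisymm h3 hij)]
      exact key j i h

/-! ### `d`-stochastic matrices and the easy inclusion -/

lemma IsDStochastic.one (d : Fin n → ℝ) : IsDStochastic d 1 :=
  ⟨one_mem _, Matrix.one_mulVec d⟩

lemma IsDStochastic.mul {d : Fin n → ℝ} {M N : Matrix (Fin n) (Fin n) ℝ}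
    (hM : IsDStochastic d M) (hN : IsDStochastic d N) : IsDStochastic d (M * N) :=
  ⟨mul_mem hM.1 hN.1, by rw [← Matrix.mulVec_mulVec, hN.2, hM.2]⟩

lemma isDStochastic_iff {d : Fin n → ℝ} {M : Matrix (Fin n) (Fin n) ℝ} :
    IsDStochastic d M ↔ (∀ i j, 0 ≤ M i j) ∧ (∀ j, ∑ i, M i j = 1) ∧
      ∀ i, ∑ j, M i j * d j = d i := by
  rw [IsDStochastic, Matrix.mem_colStochastic_iff_sum, and_assoc, funext_iff]
  rfl

lemma list_prod_isDStochastic {d : Fin n → ℝ} (hd : ∀ i, 0 < d i)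
    (L : List (Matrix (Fin n) (Fin n) ℝ)) (hL : ∀ P ∈ L, IsDSwap d P) :
    IsDStochastic d L.prod := by
  induction L with
  | nil => simpa using IsDStochastic.one d
  | cons P L ih =>
    rw [List.prod_cons]
    obtain ⟨i, j, hij, rfl⟩ := (isDSwap_iff hd P).1 (hL P (by simp))
    exact (orderedSwap_isDStochastic hd hij).mul (ih fun Q hQ => hL Q (by simp [hQ]))

lemma convex_polytopeTO (d : Fin n → ℝ) : Convex ℝ (polytopeTO d) := by
  intro M hM N hN s t hs ht hst
  simp only [polytopeTO, Set.mem_ofPred_eq, isDStochastic_iff] at *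
  refine ⟨fun i j => ?_, fun j => ?_, fun i => ?_⟩
  · exact add_nonneg (mul_nonneg hs (hM.1 i j)) (mul_nonneg ht (hN.1 i j))
  · simp [Finset.sum_add_distrib, ← Finset.mul_sum, hM.2.1, hN.2.1, hst]
  · simp_rw [Matrix.add_apply, Matrix.smul_apply, smul_eq_mul, add_mul, mul_assoc,
      Finset.sum_add_distrib, ← Finset.mul_sum, hM.2.2, hN.2.2, ← add_mul, hst, one_mul]

lemma polytopeETO_subset {d : Fin n → ℝ} (hd : ∀ i, 0 < d i) :
    polytopeETO d ⊆ polytopeTO d := by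
  refine convexHull_min ?_ (convex_polytopeTO d)
  rintro _ ⟨L, hL, rfl⟩
  exact list_prod_isDStochastic hd L hL

lemma polytope_eq_iff_universal {d : Fin n → ℝ} (hd : ∀ i, 0 < d i) :
    polytopeTO d = polytopeETO d ↔ StrongETOUniversal d :=
  ⟨fun h _ hM => h ▸ hM, fun h => Set.Subset.antisymm h (polytopeETO_subset hd)⟩

/-! ### Rigidity: an obstruction to being a product of swaps -/

/-- A matrix with an entry different from `0` and `1` from which no swap of two different levels
can be split off on the left, unless it can be absorbed. -/
def IsSwapRigid (d : Fin n → ℝ) (M : Matrix (Fin n) (Fin n) ℝ) : Prop :=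
  (∀ i j, d j < d i → (∃ l, d j * M i l < (d i - d j) * M j l) ∨
    ∀ l, d i * M j l = d j * M i l) ∧ ∃ k l, M k l ≠ 0 ∧ M k l ≠ 1

lemma orderedSwap_mul_apply_of_eq {d : Fin n → ℝ} {i j : Fin n} (hi : d i ≠ 0) (h : d j = d i)
    (N : Matrix (Fin n) (Fin n) ℝ) (k l : Fin n) :
    (orderedSwap d i j * N) k l = N (Equiv.swap i j k) l := by
  rw [orderedSwap_mul_apply d hi, h, div_self hi, Equiv.swap_apply_def]
  split_ifs <;> subst_vars <;> simp_all

/-- Put r = d_j/d_i and let N_k be the rows of N. The product has row i equal to N_j + (1 - r) N_i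
and row j equal to r N_i. If r < 1, nonnegativity of N excludes the strict inequality for the pair
(i, j), and proportional rows force N_j = r N_i, so the swap acts trivially on N. If r = 1, the swap
permutes two rows of equal weight. -/
lemma IsSwapRigid.of_orderedSwap_mul {d : Fin n → ℝ} (hd : ∀ i, 0 < d i) {i j : Fin n}
    (hij : d j ≤ d i) {N : Matrix (Fin n) (Fin n) ℝ} (hN : ∀ k l, 0 ≤ N k l)
    (h : IsSwapRigid d (orderedSwap d i j * N)) : IsSwapRigid d N := by
  have hi := (hd i).ne'
  rcases hij.lt_or_eq with hlt | heq
  · have hne : i ≠ j := fun h => by simp [h] at hlt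
    have hil : ∀ l, (orderedSwap d i j * N) i l = N i l + (N j l - d j / d i * N i l) := by
      intro l; simp [orderedSwap_mul_apply d hi, hne]
    have hjl : ∀ l, (orderedSwap d i j * N) j l = d j / d i * N i l := by
      intro l; simp [orderedSwap_mul_apply d hi, hne.symm]
    have hr : d j / d i * d i = d j := div_mul_cancel₀ _ hi
    rcases h.1 i j hlt with ⟨l, hl⟩ | hprop
    · rw [hil, hjl] at hl
      have := mul_nonneg (hd j).le (hN j l)
      have : (d i - d j) * (d j / d i * N i l) = (d j - d j * (d j / d i)) * N i l := by
        linear_combination N i l * hr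
      linarith
    · have hrow : ∀ l, N j l - d j / d i * N i l = 0 := by
        intro l
        have := hprop l
        rw [hil, hjl] at this
        refine (mul_eq_zero.1 (?_ : d j * _ = 0)).resolve_left (hd j).ne'
        linear_combination N i l * hr - this
      have hfix : orderedSwap d i j * N = N := by
        ext k l
        rw [orderedSwap_mul_apply d hi, hrow, mul_zero, add_zero]
      rwa [hfix] at h
  · have hentry := orderedSwap_mul_apply_of_eq hi heq N
    have hds : ∀ k, d (Equiv.swap i j k) = d k := by
      intro k
      rw [Equiv.swap_apply_def]
      split_ifs <;> subst_vars <;> simp_all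
    refine ⟨fun p q hpq => ?_, ?_⟩
    · have := h.1 (Equiv.swap i j p) (Equiv.swap i j q) (by simpa only [hds] using hpq)
      simpa only [hentry, hds, Equiv.swap_apply_self] using this
    · obtain ⟨k, l, hkl⟩ := h.2
      exact ⟨_, _, by simpa only [hentry] using hkl⟩

lemma not_isSwapRigid_one (d : Fin n → ℝ) : ¬ IsSwapRigid d 1 := by
  rintro ⟨-, k, l, h0, h1⟩
  rw [Matrix.one_apply] at h0 h1
  split_ifs at h0 h1 <;> simp_all

lemma IsSwapRigid.notMem_dSwapProducts {d : Fin n → ℝ} (hd : ∀ i, 0 < d i)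
    {M : Matrix (Fin n) (Fin n) ℝ} (hM : IsSwapRigid d M) : M ∉ dSwapProducts d := by
  rintro ⟨L, hL, rfl⟩
  induction L with
  | nil => exact not_isSwapRigid_one d hM
  | cons P L ih =>
    have hL' : ∀ Q ∈ L, IsDSwap d Q := fun Q hQ => hL Q (by simp [hQ])
    obtain ⟨i, j, hij, rfl⟩ := (isDSwap_iff hd P).1 (hL P (by simp))
    rw [List.prod_cons] at hM
    exact ih hL' (hM.of_orderedSwap_mul hd hij
      (isDStochastic_iff.1 (list_prod_isDStochastic hd L hL')).1)

/-- A `d`-stochastic matrix that is determined by its support is an extreme point. -/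
lemma mem_extremePoints_of_support {d : Fin n → ℝ} {M : Matrix (Fin n) (Fin n) ℝ}
    (hM : IsDStochastic d M)
    (h : ∀ X, IsDStochastic d X → (∀ k l, M k l = 0 → X k l = 0) → X = M) :
    M ∈ (polytopeTO d).extremePoints ℝ := by
  refine ⟨hM, fun X hX Y hY hXY => h X hX fun k l hkl => ?_⟩
  obtain ⟨s, t, hs, ht, -, rfl⟩ := hXY
  have h1 := mul_nonneg hs.le ((isDStochastic_iff.1 hX).1 k l)
  have h2 := mul_nonneg ht.le ((isDStochastic_iff.1 hY).1 k l)
  simp only [Matrix.add_apply, Matrix.smul_apply, smul_eq_mul] at hkl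
  have : s * X k l = 0 := by linarith
  exact (mul_eq_zero.1 this).resolve_left hs.ne'

lemma not_universal_of_extreme {d : Fin n → ℝ} (hd : ∀ i, 0 < d i)
    {M : Matrix (Fin n) (Fin n) ℝ} (hM : M ∈ (polytopeTO d).extremePoints ℝ)
    (hR : IsSwapRigid d M) : ¬ StrongETOUniversal d := by
  intro h
  have heq := (polytope_eq_iff_universal hd).2 h
  rw [heq] at hM
  exact hR.notMem_dSwapProducts hd (extremePoints_convexHull_subset hM)

/-! ### Extending a small block by the identity -/

/-- The matrix with the block `m` on the levels in the range of `f`, and the identity elsewhere. -/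
noncomputable def blockExtend {ι : Type*} [Fintype ι] (f : ι → Fin n) (m : Matrix ι ι ℝ) :
    Matrix (Fin n) (Fin n) ℝ :=
  open Classical in Matrix.of fun k l =>
    if k ∈ Set.range f then ∑ i, ∑ j, if f i = k ∧ f j = l then m i j else 0
    else if k = l then 1 else 0

section blockExtend

variable {ι : Type*} [Fintype ι] {f : ι → Fin n} {d : Fin n → ℝ} {m : Matrix ι ι ℝ}

lemma blockExtend_apply (hf : Function.Injective f) (i j : ι) :
    blockExtend f m (f i) (f j) = m i j := by
  classical
  simp [blockExtend, hf.eq_iff, ite_and]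

lemma blockExtend_row (k l : Fin n) (hk : k ∉ Set.range f) :
    blockExtend f m k l = if k = l then 1 else 0 := by
  simp only [blockExtend, Matrix.of_apply, if_neg hk]

lemma blockExtend_col (k l : Fin n) (hl : l ∉ Set.range f) :
    blockExtend f m k l = if k = l then 1 else 0 := by
  by_cases hk : k ∈ Set.range f
  · have hkl : k ≠ l := fun h => hl (h ▸ hk)
    have hl' : ∀ j, f j ≠ l := fun j hj => hl ⟨j, hj⟩
    simp [blockExtend, hkl, hl']
  · exact blockExtend_row k l hk

lemma sum_eq_sum_comp (hf : Function.Injective f) {g : Fin n → ℝ}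
    (hg : ∀ k, k ∉ Set.range f → g k = 0) : ∑ k, g k = ∑ i, g (f i) :=
  (Fintype.sum_of_injective f hf _ _ hg fun _ => rfl).symm

lemma blockExtend_isDStochastic (hf : Function.Injective f) (h0 : ∀ i j, 0 ≤ m i j)
    (h1 : ∀ j, ∑ i, m i j = 1) (h2 : ∀ i, ∑ j, m i j * d (f j) = d (f i)) :
    IsDStochastic d (blockExtend f m) := by
  refine isDStochastic_iff.2 ⟨fun k l => ?_, fun l => ?_, fun k => ?_⟩
  · by_cases hk : k ∈ Set.range f
    · by_cases hl : l ∈ Set.range f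
      · obtain ⟨i, rfl⟩ := hk
        obtain ⟨j, rfl⟩ := hl
        rw [blockExtend_apply hf]
        exact h0 i j
      · rw [blockExtend_col k l hl]; split_ifs <;> norm_num
    · rw [blockExtend_row k l hk]; split_ifs <;> norm_num
  · by_cases hl : l ∈ Set.range f
    · obtain ⟨j, rfl⟩ := hl
      rw [sum_eq_sum_comp hf]
      · simp_rw [blockExtend_apply hf, h1]
      · intro k hk
        rw [blockExtend_row k _ hk, if_neg (fun h => hk ⟨j, h.symm⟩)]
    · simp_rw [fun k => blockExtend_col (m := m) k l hl]
      simp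
  · by_cases hk : k ∈ Set.range f
    · obtain ⟨i, rfl⟩ := hk
      rw [sum_eq_sum_comp hf]
      · simp_rw [blockExtend_apply hf, h2]
      · intro l hl
        rw [blockExtend_col _ l hl, if_neg (fun h => hl ⟨i, h⟩), zero_mul]
    · simp_rw [fun l => blockExtend_row (m := m) k l hk]
      simp

lemma eq_blockExtend (hf : Function.Injective f) {X : Matrix (Fin n) (Fin n) ℝ}
    (hX : IsDStochastic d X) (hsupp : ∀ k l, blockExtend f m k l = 0 → X k l = 0)
    (huniq : ∀ x : Matrix ι ι ℝ, (∀ j, ∑ i, x i j = 1) →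
      (∀ i, ∑ j, x i j * d (f j) = d (f i)) → (∀ i j, m i j = 0 → x i j = 0) → x = m) :
    X = blockExtend f m := by
  obtain ⟨-, h1, h2⟩ := isDStochastic_iff.1 hX
  have hrow : ∀ k l, k ∉ Set.range f → k ≠ l → X k l = 0 := fun k l hk hkl =>
    hsupp k l (by rw [blockExtend_row k l hk, if_neg hkl])
  have hcol : ∀ k l, l ∉ Set.range f → k ≠ l → X k l = 0 := fun k l hl hkl =>
    hsupp k l (by rw [blockExtend_col k l hl, if_neg hkl])
  have hdiag : ∀ l, l ∉ Set.range f → X l l = 1 := by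
    intro l hl
    rw [← h1 l, Finset.sum_eq_single l (fun k _ hk => hcol k l hl hk) (by simp)]
  have hx : X.submatrix f f = m := by
    refine huniq _ (fun j => ?_) (fun i => ?_) fun i j hij => ?_
    · rw [← h1 (f j), sum_eq_sum_comp hf]
      · rfl
      · exact fun k hk => hrow k _ hk fun h => hk ⟨j, h.symm⟩
    · rw [← h2 (f i), sum_eq_sum_comp hf]
      · rfl
      · exact fun l hl => by rw [hcol _ l hl fun h => hl ⟨i, h⟩, zero_mul]
    · exact hsupp _ _ (by rw [blockExtend_apply hf, hij])
  ext k l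
  by_cases hk : k ∈ Set.range f
  · by_cases hl : l ∈ Set.range f
    · obtain ⟨i, rfl⟩ := hk
      obtain ⟨j, rfl⟩ := hl
      rw [blockExtend_apply hf, ← hx, Matrix.submatrix_apply]
    · have hkl : k ≠ l := fun h => hl (h ▸ hk)
      rw [blockExtend_col k l hl, if_neg hkl, hcol k l hl hkl]
  · rw [blockExtend_row k l hk]
    split_ifs with hkl
    · rw [← hkl, hdiag k hk]
    · exact hrow k l hk hkl

/-- Only pairs inside the block need a hypothesis. If j is outside, column j has 0 in row i and 1 in
row j. If only i is outside, row i vanishes on the block columns while row j has a positive entry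
there, since its weighted sum is d_j > 0. -/
lemma blockExtend_isSwapRigid (hd : ∀ i, 0 < d i) (hf : Function.Injective f)
    (h2 : ∀ i, ∑ j, m i j * d (f j) = d (f i))
    (h : ∀ i j, d (f j) < d (f i) → (∃ l, d (f j) * m i l < (d (f i) - d (f j)) * m j l) ∨
      ∀ l, d (f i) * m j l = d (f j) * m i l) (h' : ∃ k l, m k l ≠ 0 ∧ m k l ≠ 1) :
    IsSwapRigid d (blockExtend f m) := by
  refine ⟨fun i j hij => ?_, ?_⟩
  · have hne : i ≠ j := fun h => by simp [h] at hij
    by_cases hj : j ∈ Set.range f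
    · obtain ⟨q, rfl⟩ := hj
      by_cases hi : i ∈ Set.range f
      · obtain ⟨p, rfl⟩ := hi
        rcases h p q hij with ⟨l, hl⟩ | hall
        · exact Or.inl ⟨f l, by simpa only [blockExtend_apply hf] using hl⟩
        · refine Or.inr fun l => ?_
          by_cases hl : l ∈ Set.range f
          · obtain ⟨l, rfl⟩ := hl
            simpa only [blockExtend_apply hf] using hall l
          · rw [blockExtend_col _ l hl, blockExtend_col _ l hl, if_neg (fun h => hl ⟨q, h⟩),
              if_neg (fun h => hl ⟨p, h⟩), mul_zero, mul_zero]
      · left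
        have hpos : 0 < ∑ l, m q l * d (f l) := by rw [h2]; exact hd _
        obtain ⟨l, -, hl⟩ := Finset.exists_lt_of_sum_lt
          (show ∑ l : ι, (0 : ℝ) < ∑ l, m q l * d (f l) by simpa using hpos)
        refine ⟨f l, ?_⟩
        rw [blockExtend_row _ _ hi, if_neg (fun h => hi ⟨l, h.symm⟩), blockExtend_apply hf,
          mul_zero]
        exact mul_pos (sub_pos.2 hij) (pos_of_mul_pos_left hl (hd _).le)
    · left
      refine ⟨j, ?_⟩
      rw [blockExtend_col i j hj, blockExtend_col j j hj, if_neg hne, if_pos rfl]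
      linarith
  · obtain ⟨k, l, hkl⟩ := h'
    exact ⟨f k, f l, by rwa [blockExtend_apply hf]⟩

lemma not_universal_of_block (hd : ∀ i, 0 < d i) (hf : Function.Injective f)
    (h0 : ∀ i j, 0 ≤ m i j) (h1 : ∀ j, ∑ i, m i j = 1)
    (h2 : ∀ i, ∑ j, m i j * d (f j) = d (f i))
    (huniq : ∀ x : Matrix ι ι ℝ, (∀ j, ∑ i, x i j = 1) →
      (∀ i, ∑ j, x i j * d (f j) = d (f i)) → (∀ i j, m i j = 0 → x i j = 0) → x = m)
    (h : ∀ i j, d (f j) < d (f i) → (∃ l, d (f j) * m i l < (d (f i) - d (f j)) * m j l) ∨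
      ∀ l, d (f i) * m j l = d (f j) * m i l) (h' : ∃ k l, m k l ≠ 0 ∧ m k l ≠ 1) :
    ¬ StrongETOUniversal d :=
  not_universal_of_extreme hd
    (mem_extremePoints_of_support (blockExtend_isDStochastic hf h0 h1 h2)
      fun _ hX hs => eq_blockExtend hf hX hs huniq)
    (blockExtend_isSwapRigid hd hf h2 h h')

end blockExtend

/-! ### Extreme rigid matrices for non-flat vectors -/

lemma not_universal_of_triple {d : Fin n → ℝ} (hd : ∀ i, 0 < d i) {a b c : Fin n}
    (hbc : b ≠ c) (hab : d b < d a) (hcb : d c ≤ d b) : ¬ StrongETOUniversal d := by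
  have hab' : a ≠ b := fun h => by simp [h] at hab
  have hac' : a ≠ c := fun h => by rw [h] at hab; linarith
  have hf : Function.Injective ![a, b, c] := by
    intro i j
    fin_cases i <;> fin_cases j <;> simp [hab', hac', hbc, hab'.symm, hac'.symm, hbc.symm]
  have ha := hd a
  have hb := hd b
  have hc := hd c
  have hba0 : d b / d a ≠ 0 := (div_pos hb ha).ne'
  have hba1 : d b / d a ≠ 1 := ((div_lt_one ha).2 hab).ne
  rcases le_or_gt (d b + d c) (d a) with hle | hgt
  -- Level a can feed both b and c entirely, while b and c are sent to a. Rows b and c are then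
  -- proportional, which is the absorbed case of rigidity.
  · refine not_universal_of_block (f := ![a, b, c])
      (m := !![1 - (d b + d c) / d a, 1, 1; d b / d a, 0, 0; d c / d a, 0, 0])
      hd hf ?_ ?_ ?_ ?_ ?_ ⟨1, 0, hba0, hba1⟩
    · have := (div_le_one ha).2 hle
      simp [Fin.forall_fin_succ]
      refine ⟨this, ?_, ?_⟩ <;> positivity
    · simp [Fin.forall_fin_succ, Fin.sum_univ_three]
      field_simp
      ring
    · simp [Fin.forall_fin_succ, Fin.sum_univ_three]
      field_simp
      ring_nf
      simp
    · intro x h1 h2 h3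
      simp [Fin.forall_fin_succ, Fin.sum_univ_three] at h1 h2 h3
      obtain ⟨h10, h11, h12⟩ := h1
      obtain ⟨-, h21, h22⟩ := h2
      obtain ⟨-, ⟨-, e11, e12⟩, -, e21, e22⟩ := h3
      rw [e11, e12] at h21
      rw [e21, e22] at h22
      have e10 : x 1 0 = d b / d a := by rw [eq_div_iff ha.ne']; linarith
      have e20 : x 2 0 = d c / d a := by rw [eq_div_iff ha.ne']; linarith
      have e00 : x 0 0 = 1 - (d b + d c) / d a := by rw [add_div]; linarith
      have e01 : x 0 1 = 1 := by linarith
      have e02 : x 0 2 = 1 := by linarith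
      rw [Matrix.eta_fin_three x, e00, e01, e02, e10, e11, e12, e20, e21, e22]
    · simp [Fin.forall_fin_succ, Fin.exists_fin_succ]
      have hB : d a * (d b / d a) = d b := mul_div_cancel₀ _ ha.ne'
      have hC : d a * (d c / d a) = d c := mul_div_cancel₀ _ ha.ne'
      have hbC : 0 < d b * (d c / d a) := by positivity
      have hcB : 0 < d c * (d b / d a) := by positivity
      have hsum := add_div (d b) (d c) (d a)
      refine ⟨⟨fun _ => Or.inl (Or.inl ?_), fun _ => Or.inl (Or.inl ?_)⟩,
        ⟨fun h => absurd h hab.not_gt, fun _ => Or.inr (by ring)⟩,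
        fun h => absurd h (hcb.trans hab.le).not_gt, fun h => absurd h hcb.not_gt⟩
      · rw [hsum, sub_mul, hB]
        linarith
      · rw [hsum, sub_mul, hC]
        linarith
  -- Here a is too small to feed both: it fills b, gives the rest to c, and b supplies what c still
  -- lacks. The pair (b, c) is rigid through column b, whose entry in row c is positive because d_b
  -- + d_c > d_a.
  · refine not_universal_of_block (f := ![a, b, c])
      (m := !![0, (d a - d c) / d b, 1; d b / d a, 0, 0;
        (d a - d b) / d a, (d b + d c - d a) / d b, 0])
      hd hf ?_ ?_ ?_ ?_ ?_ ⟨1, 0, hba0, hba1⟩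
    · simp [Fin.forall_fin_succ]
      refine ⟨?_, ?_, ?_, ?_⟩ <;> apply div_nonneg <;> linarith
    · simp [Fin.forall_fin_succ, Fin.sum_univ_three]
      constructor <;> field_simp <;> ring
    · simp [Fin.forall_fin_succ, Fin.sum_univ_three]
      field_simp
      simp
    · intro x h1 h2 h3
      simp [Fin.forall_fin_succ, Fin.sum_univ_three] at h1 h2 h3
      obtain ⟨h10, h11, h12⟩ := h1
      obtain ⟨h20, h21, h22⟩ := h2
      obtain ⟨⟨e00, -⟩, ⟨-, e11, e12⟩, -, -, e22⟩ := h3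
      rw [e11, e12] at h21
      have e10 : x 1 0 = d b / d a := by rw [eq_div_iff ha.ne']; linarith
      have e20 : x 2 0 = (d a - d b) / d a := by
        rw [sub_div, div_self ha.ne']; linarith
      have e02 : x 0 2 = 1 := by linarith
      rw [e00, e02] at h20
      have e01 : x 0 1 = (d a - d c) / d b := by rw [eq_div_iff hb.ne']; linarith
      have e21 : x 2 1 = (d b + d c - d a) / d b := by
        rw [eq_div_iff hb.ne']
        rw [eq_div_iff hb.ne'] at e01
        linear_combination d b * h11 - d b * e11 - e01
      rw [Matrix.eta_fin_three x, e00, e01, e02, e10, e11, e12, e20, e21, e22]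
    · simp [Fin.forall_fin_succ, Fin.exists_fin_succ]
      refine ⟨⟨fun _ => Or.inl (Or.inl ?_), fun _ => Or.inl (Or.inl ?_)⟩,
        ⟨fun h => absurd h hab.not_gt, fun h => Or.inl (Or.inr ?_)⟩,
        fun h => absurd h (hcb.trans hab.le).not_gt, fun h => absurd h hcb.not_gt⟩
      · exact mul_pos (sub_pos.2 hab) (div_pos hb ha)
      · exact mul_pos (sub_pos.2 (hcb.trans_lt hab)) (div_pos (sub_pos.2 hab) ha)
      · exact mul_pos (sub_pos.2 h) (div_pos (sub_pos.2 hgt) hb)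

lemma hasFlatForm_of_universal {d : Fin n → ℝ} (hn : n ≠ 0) (hd : ∀ i, 0 < d i)
    (h : StrongETOUniversal d) : HasFlatForm d := by
  obtain ⟨n, rfl⟩ := Nat.exists_eq_succ_of_ne_zero hn
  set σ := Tuple.sort (fun i => -d i) with hσ
  have hanti := decreasing_antitone d
  refine ⟨decreasing d 0, decreasing d (Fin.last n), hd _, hanti (Fin.zero_le _), ?_⟩
  funext i
  split_ifs with hi
  · congr 1
    exact Fin.ext (by simpa using hi)
  · refine le_antisymm (hanti (Fin.zero_le _)) (not_lt.1 fun hlt => ?_)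
    have hne : i ≠ Fin.last n := fun h => hi (by simp [h])
    exact not_universal_of_triple hd (a := σ 0) (b := σ i) (c := σ (Fin.last n))
      (σ.injective.ne hne) hlt (hanti (Fin.le_last _)) h

/-! ### `polytopeETO d` as a convex monoid, and its permutation-like elements -/

lemma one_mem_polytopeETO (d : Fin n → ℝ) : 1 ∈ polytopeETO d :=
  subset_convexHull ℝ _ ⟨[], by simp, by simp⟩

lemma orderedSwap_mem_polytopeETO {d : Fin n → ℝ} (hd : ∀ i, 0 < d i) {i j : Fin n}
    (hij : d j ≤ d i) : orderedSwap d i j ∈ polytopeETO d :=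
  subset_convexHull ℝ _ ⟨[orderedSwap d i j],
    by simpa using (isDSwap_iff hd _).2 ⟨i, j, hij, rfl⟩, by simp⟩

lemma polytopeETO_mul_mem {d : Fin n → ℝ} {M N : Matrix (Fin n) (Fin n) ℝ}
    (hM : M ∈ polytopeETO d) (hN : N ∈ polytopeETO d) : M * N ∈ polytopeETO d := by
  have hconv : Convex ℝ (polytopeETO d) := convex_convexHull ℝ _
  have h1 : polytopeETO d ⊆ {N | ∀ M ∈ dSwapProducts d, M * N ∈ polytopeETO d} := by
    refine convexHull_min ?_ ?_
    · rintro _ ⟨L, hL, rfl⟩ _ ⟨K, hK, rfl⟩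
      refine subset_convexHull ℝ _ ⟨K ++ L, fun P hP => ?_, by simp⟩
      exact (List.mem_append.1 hP).elim (hK P) (hL P)
    · intro X hX Y hY s t hs ht hst M hM
      rw [mul_add, mul_smul_comm, mul_smul_comm]
      exact hconv (hX M hM) (hY M hM) hs ht hst
  have h2 : polytopeETO d ⊆ {M | M * N ∈ polytopeETO d} := by
    refine convexHull_min (fun M hM => h1 hN M hM) ?_
    intro X hX Y hY s t hs ht hst
    change (s • X + t • Y) * N ∈ polytopeETO d
    rw [add_mul, smul_mul_assoc, smul_mul_assoc]
    exact hconv hX hY hs ht hst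
  exact h2 hM

/-- The matrix with `e_j ↦ e_{σ j}`. -/
def permCol (σ : Equiv.Perm (Fin n)) : Matrix (Fin n) (Fin n) ℝ :=
  Matrix.of fun k l => if k = σ l then 1 else 0

/-- The matrix with `e_j ↦ r e_{σ j} + (1 - r) e_j` for `j ≠ z` and `e_z ↦ e_{σ z}`. -/
def lazyPermCol (r : ℝ) (z : Fin n) (σ : Equiv.Perm (Fin n)) : Matrix (Fin n) (Fin n) ℝ :=
  Matrix.of fun k l => if l = z then (if k = σ l then 1 else 0) else
    r * (if k = σ l then 1 else 0) + (1 - r) * if k = l then 1 else 0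

lemma permCol_one : permCol (1 : Equiv.Perm (Fin n)) = 1 := by
  ext k l
  simp [permCol, Matrix.one_apply]
  rfl

lemma permCol_mul (σ τ : Equiv.Perm (Fin n)) : permCol (σ * τ) = permCol σ * permCol τ := by
  ext k l
  simp [permCol, Matrix.mul_apply]
  rfl

lemma permCol_mul_apply (σ : Equiv.Perm (Fin n)) (N : Matrix (Fin n) (Fin n) ℝ) (k l : Fin n) :
    (permCol σ * N) k l = N (σ.symm k) l := by
  simp [permCol, Matrix.mul_apply, ← Equiv.symm_apply_eq]

lemma orderedSwap_eq_permCol {d : Fin n → ℝ} {i j : Fin n} (hi : d i ≠ 0) (h : d j = d i) :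
    orderedSwap d i j = permCol (Equiv.swap i j) := by
  ext k l
  rw [orderedSwap_eq d hi, h, div_self hi]
  simp only [permCol, Matrix.add_apply, Matrix.vecMulVec_apply, Matrix.one_apply, Matrix.of_apply,
    Pi.sub_apply, Pi.single_apply, Pi.smul_apply, smul_eq_mul, Equiv.swap_apply_def]
  split_ifs <;> simp_all

section Flat

variable {d : Fin n → ℝ} {z : Fin n} {δ₀ δ₁ : ℝ}

/-- All levels other than z have equal weight, so swaps among them are transpositions, and these
generate the permutations fixing z. -/
lemma permCol_mem (hd : ∀ i, 0 < d i) (hδ : ∀ i, i ≠ z → d i = δ₀) (σ : Equiv.Perm (Fin n)) :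
    σ z = z → permCol σ ∈ polytopeETO d := by
  intro hσ
  induction hs : σ.support.card using Nat.strong_induction_on generalizing σ with
  | _ N ih =>
    by_cases h1 : σ = 1
    · rw [h1, permCol_one]
      exact one_mem_polytopeETO d
    · obtain ⟨x, hx⟩ : ∃ x, σ x ≠ x := by
        by_contra! h
        exact h1 (Equiv.ext h)
      have hxz : x ≠ z := fun h => hx (h ▸ hσ)
      have hσxz : σ x ≠ z := fun h => hxz (σ.injective (h.trans hσ.symm))
      have hmul : σ = Equiv.swap x (σ x) * (Equiv.swap x (σ x) * σ) := by
        rw [Equiv.swap_mul_self_mul]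
      rw [hmul, permCol_mul, ← orderedSwap_eq_permCol (d := d) (hd x).ne'
        (by rw [hδ _ hxz, hδ _ hσxz])]
      refine polytopeETO_mul_mem
        (orderedSwap_mem_polytopeETO hd (by rw [hδ _ hxz, hδ _ hσxz])) ?_
      refine ih _ (hs ▸ Equiv.Perm.card_support_swap_mul hx) _ ?_ rfl
      rw [Equiv.Perm.mul_apply, hσ, Equiv.swap_apply_of_ne_of_ne hxz.symm hσxz.symm]

/-- The swap sends e_z to e_m and e_m to r e_z + (1 - r) e_m. The second is exactly column m of the
left side, and `Equiv.swap m z * σ` fixes m, so σ acquires a fixed point. -/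
lemma lazyPermCol_eq_mul (hδ : ∀ i, i ≠ z → d i = δ₀) (hz : d z = δ₁) (hδ₀ : δ₀ ≠ 0)
    (σ : Equiv.Perm (Fin n)) {m : Fin n} (hm : σ m = z) (hmz : m ≠ z) :
    lazyPermCol (δ₁ / δ₀) z σ =
      orderedSwap d m z * lazyPermCol (δ₁ / δ₀) z (Equiv.swap m z * σ) := by
  have hdm : d m = δ₀ := hδ m hmz
  ext k l
  have hinj : ∀ l, σ l = z ↔ l = m := fun l => by rw [← hm, σ.injective.eq_iff]
  rw [orderedSwap_mul_apply d (hdm ▸ hδ₀), hz, hdm]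
  simp only [lazyPermCol, Matrix.of_apply, Equiv.Perm.mul_apply, Equiv.swap_apply_def]
  by_cases hl : l = z
  · subst hl
    have : σ l ≠ l := fun h => hmz ((hinj l).1 h).symm
    by_cases h2 : σ l = m
    · simp [h2, hmz]
    · simp [h2, this, Ne.symm this, Ne.symm h2]
  · by_cases hlm : l = m
    · subst hlm
      simp [hl, hm, Ne.symm hl]
      split_ifs <;> ring
    · have : σ l ≠ z := fun h => hlm ((hinj l).1 h)
      by_cases h2 : σ l = m
      · simp [hl, h2, hmz, Ne.symm hlm, Ne.symm hl]
        split_ifs <;> ring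
      · simp [hl, this, h2, Ne.symm hlm, Ne.symm hl, Ne.symm this, Ne.symm h2]

lemma lazyPermCol_mem (hd : ∀ i, 0 < d i) (hδ : ∀ i, i ≠ z → d i = δ₀) (hz : d z = δ₁)
    (h0 : 0 < δ₁) (h1 : δ₁ ≤ δ₀) (σ : Equiv.Perm (Fin n)) :
    lazyPermCol (δ₁ / δ₀) z σ ∈ polytopeETO d := by
  have hδ₀ : 0 < δ₀ := h0.trans_le h1
  have hr1 : δ₁ / δ₀ ≤ 1 := (div_le_one hδ₀).2 h1
  induction hs : σ.support.card using Nat.strong_induction_on generalizing σ with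
  | _ N ih =>
    by_cases hσ : σ z = z
    -- Once σ fixes z, the lazy matrix is a genuine mixture of σ and the identity, column z
    -- included.
    · have : lazyPermCol (δ₁ / δ₀) z σ =
          (δ₁ / δ₀) • permCol σ + (1 - δ₁ / δ₀) • (1 : Matrix (Fin n) (Fin n) ℝ) := by
        ext k l
        simp only [lazyPermCol, permCol, Matrix.of_apply, Matrix.add_apply, Matrix.smul_apply,
          smul_eq_mul, Matrix.one_apply]
        by_cases hl : l = z
        · subst hl
          rw [if_pos rfl, hσ]
          ring
        · rw [if_neg hl]
      rw [this]
      exact convex_convexHull ℝ _ (permCol_mem hd hδ σ hσ) (one_mem_polytopeETO d)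
        (div_pos h0 hδ₀).le (sub_nonneg.2 hr1) (by ring)
    · set m := σ.symm z with hm
      have hmσ : σ m = z := by simp [hm]
      have hmz : m ≠ z := fun h => hσ (by rw [h] at hmσ; exact hmσ)
      rw [lazyPermCol_eq_mul hδ hz hδ₀.ne' σ hmσ hmz]
      refine polytopeETO_mul_mem
        (orderedSwap_mem_polytopeETO hd (by rw [hz, hδ m hmz]; exact h1)) ?_
      refine ih _ ?_ _ rfl
      rw [← hs, ← hmσ]
      exact Equiv.Perm.card_support_swap_mul (by rw [hmσ]; exact hmz.symm)

/-! ### Permutations in the support, by Hall's theorem -/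

/-- The weight of a set of rows is at most that of a set of columns supporting them. -/
lemma sum_le_sum_biUnion {M : Matrix (Fin n) (Fin n) ℝ} {s : ℝ} (hd : ∀ i, 0 < d i) (hs : 0 < s)
    (h0 : ∀ i j, 0 ≤ M i j) (h1 : ∀ j, ∑ i, M i j = s)
    (h2 : ∀ i, ∑ j, M i j * d j = s * d i) (S T : Finset (Fin n))
    (hST : ∀ i ∈ S, ∀ j, M i j ≠ 0 → j ∈ T) : ∑ i ∈ S, d i ≤ ∑ j ∈ T, d j := by
  refine le_of_mul_le_mul_left ?_ hs
  calc s * ∑ i ∈ S, d i = ∑ i ∈ S, ∑ j, M i j * d j := by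
        rw [Finset.mul_sum]; simp_rw [h2]
    _ = ∑ i ∈ S, ∑ j ∈ T, M i j * d j := by
        refine Finset.sum_congr rfl fun i hi =>
          (Finset.sum_subset (Finset.subset_univ T) fun j _ hj => ?_).symm
        rw [not_not.1 (mt (hST i hi j) hj), zero_mul]
    _ = ∑ j ∈ T, (∑ i ∈ S, M i j) * d j := by
        rw [Finset.sum_comm]; simp_rw [Finset.sum_mul]
    _ ≤ ∑ j ∈ T, s * d j := by
        refine Finset.sum_le_sum fun j _ => mul_le_mul_of_nonneg_right ?_ (hd j).le
        rw [← h1 j]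
        exact Finset.sum_le_univ_sum_of_nonneg fun i => h0 i j
    _ = s * ∑ j ∈ T, d j := by rw [Finset.mul_sum]

lemma sum_flat (hδ : ∀ i, i ≠ z → d i = δ₀) (hz : d z = δ₁) (S : Finset (Fin n)) :
    ∑ i ∈ S, d i = S.card * δ₀ - if z ∈ S then δ₀ - δ₁ else 0 := by
  have : ∀ i, d i = δ₀ - if i = z then δ₀ - δ₁ else 0 := by
    intro i
    split_ifs with h
    · rw [h, hz]; ring
    · rw [hδ i h]; ring
  simp_rw [this, Finset.sum_sub_distrib]
  simp

lemma exists_perm_of_hall {t : Fin n → Finset (Fin n)}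
    (ht : ∀ S : Finset (Fin n), S.card ≤ (S.biUnion t).card) :
    ∃ σ : Equiv.Perm (Fin n), ∀ j, j ∈ t (σ j) := by
  obtain ⟨f, hf, hft⟩ := (Finset.all_card_le_biUnion_card_iff_exists_injective t).1 ht
  refine ⟨(Equiv.ofBijective f (Finite.injective_iff_bijective.1 hf)).symm, fun j => ?_⟩
  have := hft ((Equiv.ofBijective f (Finite.injective_iff_bijective.1 hf)).symm j)
  rwa [Equiv.ofBijective_apply_symm_apply f] at this

lemma exists_perm_support {M : Matrix (Fin n) (Fin n) ℝ} {s : ℝ} (hd : ∀ i, 0 < d i)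
    (hs : 0 < s) (h0 : ∀ i j, 0 ≤ M i j) (h1 : ∀ j, ∑ i, M i j = s)
    (h2 : ∀ i, ∑ j, M i j * d j = s * d i) (hδ : ∀ i, i ≠ z → d i = δ₀) (hz : d z = δ₁)
    (hp : 0 < δ₁) (hle : δ₁ ≤ δ₀) :
    ∃ σ : Equiv.Perm (Fin n), ∀ j, M (σ j) j ≠ 0 := by
  classical
  obtain ⟨σ, hσ⟩ := exists_perm_of_hall (t := fun i => Finset.univ.filter fun j => M i j ≠ 0) (by
    intro S
    set T := S.biUnion fun i => Finset.univ.filter fun j => M i j ≠ 0 with hT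
    have h := sum_le_sum_biUnion hd hs h0 h1 h2 S T fun i hi j hj =>
      Finset.mem_biUnion.2 ⟨i, hi, by simpa using hj⟩
    rw [sum_flat hδ hz, sum_flat hδ hz] at h
    by_contra! hlt
    have hc : (T.card : ℝ) + 1 ≤ S.card := by exact_mod_cast hlt
    -- A set of k rows weighs at least (k - 1) δ₀ + δ₁, more than any k - 1 columns.
    have hc' := mul_le_mul_of_nonneg_right hc (hp.le.trans hle)
    split_ifs at h <;> linarith)
  exact ⟨σ, fun j => by simpa using hσ j⟩

lemma exists_perm_support_fixing {M : Matrix (Fin n) (Fin n) ℝ} {s : ℝ} (hd : ∀ i, 0 < d i)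
    (hs : 0 < s) (h0 : ∀ i j, 0 ≤ M i j) (h1 : ∀ j, ∑ i, M i j = s)
    (h2 : ∀ i, ∑ j, M i j * d j = s * d i) (hδ : ∀ i, i ≠ z → d i = δ₀) (hz : d z = δ₁)
    (hlt : δ₁ < δ₀) (hp : 0 < δ₁) :
    ∃ σ : Equiv.Perm (Fin n), σ z = z ∧ ∀ j, j ≠ z → M (σ j) j ≠ 0 := by
  classical
  set t : Fin n → Finset (Fin n) := fun i =>
    if i = z then {z} else Finset.univ.filter fun j => j ≠ z ∧ M i j ≠ 0 with ht
  have key : ∀ S : Finset (Fin n), z ∉ S → S.card ≤ (S.biUnion t).card ∧ z ∉ S.biUnion t := by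
    intro S hzS
    have hiz : ∀ i ∈ S, i ≠ z := fun i hi h => hzS (h ▸ hi)
    have hzT : z ∉ S.biUnion t := by
      rw [Finset.mem_biUnion]
      rintro ⟨i, hi, h⟩
      simp [ht, hiz i hi] at h
    refine ⟨?_, hzT⟩
    have h := sum_le_sum_biUnion hd hs h0 h1 h2 S (insert z (S.biUnion t)) fun i hi j hj => by
      by_cases hjz : j = z
      · simp [hjz]
      · exact Finset.mem_insert_of_mem
          (Finset.mem_biUnion.2 ⟨i, hi, by simp [ht, hiz i hi, hjz, hj]⟩)
    -- The count reads |S| δ₀ ≤ |T| δ₀ + δ₁ for T = `S.biUnion t`; strictness δ₁ < δ₀ makes column z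
    -- too light to replace a missing column.
    rw [Finset.sum_insert hzT, sum_flat hδ hz, sum_flat hδ hz, if_neg hzS, if_neg hzT, hz] at h
    by_contra! hcard
    have hc : ((S.biUnion t).card : ℝ) + 1 ≤ S.card := by exact_mod_cast hcard
    have hc' := mul_le_mul_of_nonneg_right hc (hp.trans hlt).le
    linarith
  obtain ⟨σ, hσ⟩ := exists_perm_of_hall (t := t) (by
    intro S
    by_cases hzS : z ∈ S
    · obtain ⟨hc, hzT⟩ := key (S.erase z) (Finset.notMem_erase z S)
      have htz : t z = {z} := by simp [ht]
      rw [← Finset.insert_erase hzS, Finset.biUnion_insert, htz, ← Finset.insert_eq,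
        Finset.card_insert_of_notMem (Finset.notMem_erase z S), Finset.card_insert_of_notMem hzT]
      lia
    · exact (key S hzS).1)
  have hσz : σ z = z := by
    by_contra h
    have := hσ z
    simp [ht, h] at this
  refine ⟨σ, hσz, fun j hj => ?_⟩
  have hne : σ j ≠ z := fun h => hj (σ.injective (h.trans hσz.symm))
  have := hσ j
  simp only [ht, if_neg hne, Finset.mem_filter] at this
  exact this.2.2

/-! ### Peeling off elements of `polytopeETO d` -/

lemma exists_mem_polytopeETO_support {M : Matrix (Fin n) (Fin n) ℝ} {s : ℝ} (hd : ∀ i, 0 < d i)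
    (hs : 0 < s) (h0 : ∀ i j, 0 ≤ M i j) (h1 : ∀ j, ∑ i, M i j = s)
    (h2 : ∀ i, ∑ j, M i j * d j = s * d i) (hδ : ∀ i, i ≠ z → d i = δ₀) (hz : d z = δ₁)
    (hp : 0 < δ₁) (hle : δ₁ ≤ δ₀) :
    ∃ E ∈ polytopeETO d, ∀ i j, M i j = 0 → E i j = 0 := by
  obtain ⟨α, hα⟩ := exists_perm_support hd hs h0 h1 h2 hδ hz hp hle
  have hβ : ∃ β : Equiv.Perm (Fin n), β z = z ∧
      ∀ j, j ≠ z → (1 - δ₁ / δ₀ = 0 ∨ M (β j) j ≠ 0) := by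
    rcases hle.lt_or_eq with hlt | heq
    · obtain ⟨β, hβz, hβ⟩ := exists_perm_support_fixing hd hs h0 h1 h2 hδ hz hlt hp
      exact ⟨β, hβz, fun j hj => Or.inr (hβ j hj)⟩
    -- When δ₁ = δ₀ the weight 1 - r of β is zero, so β need not meet the support.
    · exact ⟨1, rfl, fun j _ => Or.inl (by rw [heq, div_self (heq ▸ hp.ne'), sub_self])⟩
  obtain ⟨β, hβz, hβ⟩ := hβ
  refine ⟨permCol β * lazyPermCol (δ₁ / δ₀) z (β.symm * α), polytopeETO_mul_mem
    (permCol_mem hd hδ β hβz) (lazyPermCol_mem hd hδ hz hp hle _), fun i j hij => ?_⟩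
  have hne : i ≠ α j := fun h => hα j (h ▸ hij)
  rw [permCol_mul_apply]
  simp only [lazyPermCol, Matrix.of_apply, Equiv.Perm.mul_apply, β.symm.injective.eq_iff, if_neg hne,
    Equiv.symm_apply_eq, mul_zero, zero_add]
  split_ifs with hjz hi
  · rfl
  · subst hi
    rcases hβ j hjz with h | h
    · rw [h, zero_mul]
    · exact absurd hij h
  · simp

lemma mem_smul_polytopeETO (hd : ∀ i, 0 < d i) (hδ : ∀ i, i ≠ z → d i = δ₀) (hz : d z = δ₁)
    (hp : 0 < δ₁) (hle : δ₁ ≤ δ₀) (N : ℕ) :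
    ∀ (M : Matrix (Fin n) (Fin n) ℝ) (s : ℝ), (∀ i j, 0 ≤ M i j) → (∀ j, ∑ i, M i j = s) →
      (∀ i, ∑ j, M i j * d j = s * d i) →
      (Finset.univ.filter fun p : Fin n × Fin n => M p.1 p.2 ≠ 0).card = N →
      0 ≤ s ∧ ∃ E ∈ polytopeETO d, M = s • E := by
  induction N using Nat.strong_induction_on with
  | _ N ih =>
    intro M s h0 h1 h2 hN
    have hs : 0 ≤ s := h1 z ▸ Finset.sum_nonneg fun i _ => h0 i z
    refine ⟨hs, ?_⟩
    rcases hs.eq_or_lt with rfl | hs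
    · refine ⟨1, one_mem_polytopeETO d, ?_⟩
      ext i j
      rw [zero_smul]
      exact (Finset.sum_eq_zero_iff_of_nonneg fun i _ => h0 i j).1 (h1 j) i (Finset.mem_univ i)
    obtain ⟨E, hE, hsupp⟩ := exists_mem_polytopeETO_support hd hs h0 h1 h2 hδ hz hp hle
    obtain ⟨hE0, hE1, hE2⟩ := isDStochastic_iff.1 (polytopeETO_subset hd hE)
    have hne : (Finset.univ.filter fun p : Fin n × Fin n => E p.1 p.2 ≠ 0).Nonempty := by
      by_contra h
      rw [Finset.not_nonempty_iff_eq_empty, Finset.filter_eq_empty_iff] at h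
      have := hE1 z
      rw [Finset.sum_eq_zero fun i _ => not_not.1 (h (Finset.mem_univ (i, z)))] at this
      exact zero_ne_one this
    -- The least ratio of entries is the largest t keeping M - t E nonnegative; the entry at the
    -- minimizer p becomes zero.
    obtain ⟨p, hpE, hmin⟩ := Finset.exists_min_image _ (fun p => M p.1 p.2 / E p.1 p.2) hne
    set t := M p.1 p.2 / E p.1 p.2 with ht
    rw [Finset.mem_filter] at hpE
    have hMp : M p.1 p.2 ≠ 0 := fun h => hpE.2 (hsupp _ _ h)
    have ht0 : 0 ≤ t := div_nonneg (h0 _ _) (hE0 _ _)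
    have htp : t * E p.1 p.2 = M p.1 p.2 := div_mul_cancel₀ _ hpE.2
    have hcard : (Finset.univ.filter fun q : Fin n × Fin n => (M - t • E) q.1 q.2 ≠ 0).card < N := by
      rw [← hN]
      refine Finset.card_lt_card (Finset.ssubset_iff_subset_ne.2 ⟨fun q hq => ?_, fun h => ?_⟩)
      · refine Finset.mem_filter.2 ⟨Finset.mem_univ q, fun h => (Finset.mem_filter.1 hq).2 ?_⟩
        rw [Matrix.sub_apply, Matrix.smul_apply, h, hsupp _ _ h, smul_zero, sub_zero]
      · have hp' : p ∈ Finset.univ.filter fun p : Fin n × Fin n => M p.1 p.2 ≠ 0 :=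
          Finset.mem_filter.2 ⟨Finset.mem_univ p, hMp⟩
        rw [← h] at hp'
        refine (Finset.mem_filter.1 hp').2 ?_
        rw [Matrix.sub_apply, Matrix.smul_apply, smul_eq_mul, htp, sub_self]
    have hnonneg : ∀ i j, 0 ≤ (M - t • E) i j := by
      intro i j
      rw [Matrix.sub_apply, Matrix.smul_apply, smul_eq_mul, sub_nonneg]
      by_cases hEij : E i j = 0
      · rw [hEij, mul_zero]; exact h0 i j
      · exact (le_div_iff₀ (lt_of_le_of_ne (hE0 i j) (Ne.symm hEij))).1
          (hmin (i, j) (by simpa using hEij))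
    obtain ⟨hst, F, hF, hMF⟩ := ih _ hcard (M - t • E) (s - t) hnonneg
      (fun j => by simp [Finset.sum_sub_distrib, ← Finset.mul_sum, h1, hE1])
      (fun i => by
        simp_rw [Matrix.sub_apply, Matrix.smul_apply, smul_eq_mul, sub_mul, mul_assoc,
          Finset.sum_sub_distrib, ← Finset.mul_sum, h2, hE2]) rfl
    -- Convexity in scaled form avoids dividing by s and covers s = t; the bound t ≤ s comes from
    -- the induction hypothesis.
    have hadd : s • polytopeETO d = t • polytopeETO d + (s - t) • polytopeETO d := by
      rw [polytopeETO, ← (convex_convexHull ℝ (dSwapProducts d)).add_smul ht0 hst, add_sub_cancel]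
    obtain ⟨G, hG, hGM⟩ : M ∈ s • polytopeETO d := by
      rw [hadd]
      exact ⟨t • E, ⟨E, hE, rfl⟩, (s - t) • F, ⟨F, hF, rfl⟩, by simp only [← hMF]; abel⟩
    exact ⟨G, hG, hGM.symm⟩

end Flat

lemma HasFlatForm.universal {d : Fin n → ℝ} (hn : n ≠ 0) (hd : ∀ i, 0 < d i)
    (h : HasFlatForm d) : StrongETOUniversal d := by
  obtain ⟨n, rfl⟩ := Nat.exists_eq_succ_of_ne_zero hn
  obtain ⟨δ₀, δ₁, hp, hle, heq⟩ := h
  set σ := Tuple.sort (fun i => -d i) with hσ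
  have hdσ : ∀ i, d i = decreasing d (σ.symm i) := fun i => by simp [decreasing, ← hσ]
  have hz : d (σ (Fin.last n)) = δ₁ := by rw [hdσ, heq]; simp
  have hδ : ∀ i, i ≠ σ (Fin.last n) → d i = δ₀ := by
    intro i hi
    rw [hdσ, heq]
    refine if_neg fun h => hi ?_
    rw [← Equiv.symm_apply_eq]
    exact Fin.ext (by simpa using h)
  intro M hM
  obtain ⟨h0, h1, h2⟩ := isDStochastic_iff.1 hM
  obtain ⟨-, E, hE, hME⟩ :=
    mem_smul_polytopeETO hd hδ hz hp hle _ M 1 h0 h1 (by simpa using h2) rfl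
  rwa [hME, one_smul]

end ThermalOperations

theorem mainTheorem1 {n : ℕ} (d : Fin n → ℝ) (hd : d ∈ stdSimplex ℝ (Fin n))
    (hpos : ∀ i, 0 < d i) :
    (ThermalOperations.polytopeTO d = ThermalOperations.polytopeETO d ↔
      ThermalOperations.HasFlatForm d) ∧
    (ThermalOperations.StrongETOUniversal d ↔ ThermalOperations.HasFlatForm d) := by
  have hn : n ≠ 0 := by
    rintro rfl
    simpa using hd.2
  have key : ThermalOperations.StrongETOUniversal d ↔ ThermalOperations.HasFlatForm d :=
    ⟨ThermalOperations.hasFlatForm_of_universal hn hpos, fun h => h.universal hn hpos⟩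
  exact ⟨(ThermalOperations.polytope_eq_iff_universal hpos).trans key, key⟩
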